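/- Let $n=p+q$ be odd and let $C\!\ell_{p,q}$ be the real Clifford algebra with identity $e\equiv 1$ and generators $e_1,\dots,e_n$ satisfying $e_ae_b+e_be_a=2\eta_{ab}e$, where $\eta=\mathrm{diag}(1,\dots,1,-1,\dots,-1)$ has $p$ entries $1$ followed by $q$ entries $-1$. Let $\langle U\rangle_k$ denote the projection of $U$ onto the span of the basis elements $e_{a_1}\cdots e_{a_k}$, $a_1<\dots<a_k$; identify grade $0$ with $\mathbb R$; and put $\langle U\rangle_{\rm cen}:=\langle U\rangle_0+\langle U\rangle_n$. Let $N:=2^{(n+1)/2}$. For $A,B,C\in C\!\ell_{p,q}$ define recursively $$B'_{(0)}:=0,\quad b'_{(0)}:=-1,\quad B'_{(1)}:=B,\quad b'_{(k)}:=\frac{N/2}{k}\langle B'_{(k)}\rangle_{\rm cen},\quad B'_{(k+1)}:=B\,(B'_{(k)}-b'_{(k)}),\qquad k=1,\dots,\tfrac N2,$$ the generalized characteristic polynomial $$\varphi'_B(\lambda):=-\sum_{j=0}^{N/2}\lambda^{\frac N2-j}b'_{(j)},$$ the elements $$D:=-\sum_{j=0}^{N/2}A^{\frac N2-j}b'_{(j)},\qquad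 F:=\sum_{j=1}^{N/2}A^{\frac N2-j}\,C\,(B'_{(j-1)}-b'_{(j-1)}),$$ and $$D_{(0)}:=0,\quad d_{(0)}:=-1,\quad D_{(1)}:=D,\quad d_{(m)}:=\frac Nm\langle D_{(m)}\rangle_0\in\mathbb R,\quad D_{(m+1)}:=D\,(D_{(m)}-d_{(m)}),\qquad m=1,\dots,N.$$ Then: 1. the coefficients $b'_{(k)}$, $0\le k\le N/2$, lie in the center of $C\!\ell_{p,q}$; 2. $\varphi'_B$ is monic of degree $N/2$ and $D=\varphi'_B(A)$; 3. if $d_{(N)}\neq 0$, then the Sylvester equation $AX-XB=C$ has exactly one solution $X\in C\!\ell_{p,q}$, namely $$X=\frac{(D_{(N-1)}-d_{(N-1)})\,F}{d_{(N)}}.$$ -/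

import Mathlib

namespace CliffordSylvester

noncomputable section

/-! ### The real Clifford algebra with `p` generators of square `1` and `q` of square `-1` -/

/-- The diagonal entries of `η = diag(1, …, 1, -1, …, -1)`. -/
def eta (p q : ℕ) (a : Fin (p + q)) : ℝ := if (a : ℕ) < p then 1 else -1

/-- The quadratic form of signature `(p, q)` on `ℝ^(p+q)`. -/
def quadForm (p q : ℕ) : QuadraticForm ℝ (Fin (p + q) → ℝ) :=
  QuadraticMap.weightedSumSquares ℝ (eta p q)

/-- The real Clifford (geometric) algebra. -/
abbrev Cl (p q : ℕ) : Type := CliffordAlgebra (quadForm p q)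

/-- The generator `e_a`. -/
def gen (p q : ℕ) (a : Fin (p + q)) : Cl p q :=
  CliffordAlgebra.ι (quadForm p q) (Pi.single a 1)

/-- The basis element `e_{a₁ … a_k} = e_{a₁} ⋯ e_{a_k}` with multi-index
`I = {a₁ < ⋯ < a_k}`; the empty multi-index gives the identity. -/
def blade (p q : ℕ) (I : Finset (Fin (p + q))) : Cl p q :=
  ((I.sort (· ≤ ·)).map (gen p q)).prod

/-- The defining relations of the generators (a check on the definitions). -/
theorem gen_mul_gen_add (p q : ℕ) (a b : Fin (p + q)) :
    gen p q a * gen p q b + gen p q b * gen p q a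
      = algebraMap ℝ (Cl p q) (2 * if a = b then eta p q a else 0) := by
  rw [gen, gen, CliffordAlgebra.ι_mul_ι_add_swap]
  congr 1
  simp only [QuadraticMap.polar, quadForm, QuadraticMap.weightedSumSquares_apply, Pi.add_apply,
    ← Finset.sum_sub_distrib]
  rw [Finset.sum_eq_single a]
  · by_cases h : a = b
    · subst h; simp; ring
    · simp [h]
  · intro c _ hc
    simp [hc]
  · simp

/-! The blades form a basis: they correspond to the standard basis of the exterior algebra. -/

theorem associated_single (p q : ℕ) {a b : Fin (p + q)} (h : a ≠ b) :
    QuadraticMap.associated (R := ℝ) (-quadForm p q) (Pi.single a 1) (Pi.single b 1) = 0 := by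
  rw [QuadraticMap.associated_apply]
  have : (-quadForm p q) (Pi.single a 1 + Pi.single b 1) - (-quadForm p q) (Pi.single a 1)
      - (-quadForm p q) (Pi.single b 1) = 0 := by
    simp only [quadForm, neg_apply, QuadraticMap.weightedSumSquares_apply,
      Pi.add_apply, ← Finset.sum_neg_distrib, ← Finset.sum_sub_distrib]
    refine Finset.sum_eq_zero fun c _ => ?_
    by_cases hc : c = a
    · subst hc; simp [h]
    · simp [hc]
  rw [this, smul_zero]

theorem contractLeft_list_prod {p q : ℕ} (d : Module.Dual ℝ (Fin (p + q) → ℝ))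
    (l : List (Fin (p + q))) (h : ∀ b ∈ l, d (Pi.single b 1) = 0) :
    CliffordAlgebra.contractLeft d
      ((l.map fun b => ExteriorAlgebra.ι ℝ (Pi.single b (1 : ℝ))).prod) = 0 := by
  induction l with
  | nil => exact CliffordAlgebra.contractLeft_one (Q := (0 : QuadraticForm ℝ (Fin (p + q) → ℝ))) d
  | cons b l ih =>
    rw [List.map_cons, List.prod_cons, ExteriorAlgebra.ι, CliffordAlgebra.contractLeft_ι_mul,
      h b (by simp)]
    have := ih fun c hc => h c (by simp [hc])
    rw [ExteriorAlgebra.ι] at this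
    rw [this, zero_smul, mul_zero, sub_zero]

theorem equivExterior_list_prod (p q : ℕ) (l : List (Fin (p + q))) (hl : l.Nodup) :
    CliffordAlgebra.equivExterior (quadForm p q) ((l.map (gen p q)).prod)
      = (l.map fun b => ExteriorAlgebra.ι ℝ (Pi.single b (1 : ℝ))).prod := by
  induction l with
  | nil => exact CliffordAlgebra.changeForm_one CliffordAlgebra.changeForm.associated_neg_proof
  | cons a l ih =>
    obtain ⟨ha, hl⟩ := List.nodup_cons.mp hl
    have ih := ih hl
    rw [List.map_cons, List.prod_cons, List.map_cons, List.prod_cons, ← ih]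
    refine (CliffordAlgebra.changeForm_ι_mul
      CliffordAlgebra.changeForm.associated_neg_proof _ _).trans ?_
    refine sub_eq_self.mpr ?_
    change CliffordAlgebra.contractLeft _ (CliffordAlgebra.equivExterior (quadForm p q) _) = 0
    rw [ih]
    exact contractLeft_list_prod _ _ fun b hb =>
      associated_single p q (by rintro rfl; exact ha hb)

theorem equivExterior_blade (p q : ℕ) (I : Finset (Fin (p + q))) :
    CliffordAlgebra.equivExterior (quadForm p q) (blade p q I)
      = (Pi.basisFun ℝ (Fin (p + q))).ExteriorAlgebra I := by
  rw [blade, equivExterior_list_prod p q _ (I.sort_nodup _),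
    ExteriorAlgebra.basis_apply_ofCard (Pi.basisFun ℝ (Fin (p + q))) (rfl : I.card = I.card)]
  rw [ExteriorAlgebra.ιMulti_family, ExteriorAlgebra.ιMulti_apply]
  congr 1
  have h := Finset.listMap_orderEmbOfFin_finRange I rfl
  rw [← h, List.map_map, List.ofFn_eq_map]
  refine List.map_congr_left fun i _ => ?_
  simp [Set.powersetCard.ofFinEmbEquiv_symm_apply]

theorem blade_linearIndependent (p q : ℕ) : LinearIndependent ℝ (blade p q) := by
  refine LinearIndependent.of_comp
    (CliffordAlgebra.equivExterior (quadForm p q)).toLinearMap ?_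
  have h : (CliffordAlgebra.equivExterior (quadForm p q)).toLinearMap ∘ blade p q
      = (Pi.basisFun ℝ (Fin (p + q))).ExteriorAlgebra := funext (equivExterior_blade p q)
  rw [h]
  exact (Pi.basisFun ℝ (Fin (p + q))).ExteriorAlgebra.linearIndependent

theorem blade_span (p q : ℕ) : ⊤ ≤ Submodule.span ℝ (Set.range (blade p q)) := by
  have h : blade p q = (CliffordAlgebra.equivExterior (quadForm p q)).symm ∘
      (Pi.basisFun ℝ (Fin (p + q))).ExteriorAlgebra := by
    funext I
    rw [Function.comp_apply, ← equivExterior_blade, LinearEquiv.symm_apply_apply]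
  rw [h, Set.range_comp, ← LinearEquiv.coe_coe, Submodule.span_image, Module.Basis.span_eq,
    Submodule.map_top, LinearEquiv.range]

/-- The basis of the Clifford algebra formed by the blades. -/
def bladeBasis (p q : ℕ) : Module.Basis (Finset (Fin (p + q))) ℝ (Cl p q) :=
  Module.Basis.mk (blade_linearIndependent p q) (blade_span p q)

theorem bladeBasis_apply (p q : ℕ) (I : Finset (Fin (p + q))) :
    bladeBasis p q I = blade p q I := by
  rw [bladeBasis, Module.Basis.mk_apply]

/-! ### Grade projections -/

/-- The projection `⟨U⟩_k` onto the span of the blades with multi-indices of length `k`. -/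
def gradeProj {p q : ℕ} (k : ℕ) (U : Cl p q) : Cl p q :=
  ∑ I : Finset (Fin (p + q)) with I.card = k, (bladeBasis p q).repr U I • blade p q I

/-- The scalar part `⟨U⟩_0`, as a real number (the grade `0` subspace is identified with `ℝ`). -/
def scalarPart {p q : ℕ} (U : Cl p q) : ℝ := (bladeBasis p q).repr U ∅

theorem algebraMap_scalarPart {p q : ℕ} (U : Cl p q) :
    algebraMap ℝ (Cl p q) (scalarPart U) = gradeProj 0 U := by
  have : (Finset.univ.filter fun I : Finset (Fin (p + q)) => I.card = 0) = {∅} := by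
    ext I; simp
  rw [gradeProj, this, Finset.sum_singleton, scalarPart, blade, Algebra.algebraMap_eq_smul_one]
  simp

/-- `⟨U⟩_cen = ⟨U⟩_0 + ⟨U⟩_n`, where `n = p + q` is odd. -/
def cenProj {p q : ℕ} (U : Cl p q) : Cl p q := gradeProj 0 U + gradeProj (p + q) U

/-! ### Recursive sequences -/

/-- `N = 2 ^ [(n + 1) / 2]` with `n = p + q`. -/
def bigN (p q : ℕ) : ℕ := 2 ^ ((p + q + 1) / 2)

/-- `u_(k)` in terms of `U_(k)`: `u_(0) = -1` and `u_(k) = (N / k) ⟨U_(k)⟩_0` for `k ≥ 1`. -/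
def coeffOf {p q : ℕ} (k : ℕ) (Uk : Cl p q) : ℝ :=
  if k = 0 then -1 else (bigN p q : ℝ) / (k : ℝ) * scalarPart Uk

/-- `U_(0) = 0`, `U_(1) = U`, `U_(k+1) = U (U_(k) - u_(k))`. -/
def charElt {p q : ℕ} (U : Cl p q) : ℕ → Cl p q
  | 0 => 0
  | 1 => U
  | k + 2 => U * (charElt U (k + 1) - algebraMap ℝ (Cl p q) (coeffOf (k + 1) (charElt U (k + 1))))

/-- The characteristic polynomial coefficients `u_(k)`. -/
def charCoeff {p q : ℕ} (U : Cl p q) (k : ℕ) : ℝ := coeffOf k (charElt U k)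

/-- `b'_(k)` in terms of `B'_(k)`: `b'_(0) = -1` and
`b'_(k) = ((N / 2) / k) ⟨B'_(k)⟩_cen` for `k ≥ 1`. -/
def genCoeffOf {p q : ℕ} (k : ℕ) (Bk : Cl p q) : Cl p q :=
  if k = 0 then -1 else ((bigN p q : ℝ) / 2 / (k : ℝ)) • cenProj Bk

/-- `B'_(0) = 0`, `B'_(1) = B`, `B'_(k+1) = B (B'_(k) - b'_(k))`. -/
def genElt {p q : ℕ} (B : Cl p q) : ℕ → Cl p q
  | 0 => 0
  | 1 => B
  | k + 2 => B * (genElt B (k + 1) - genCoeffOf (k + 1) (genElt B (k + 1)))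

/-- The generalized characteristic polynomial coefficients `b'_(k)`. -/
def genCoeff {p q : ℕ} (B : Cl p q) (k : ℕ) : Cl p q := genCoeffOf k (genElt B k)

/-- The generalized characteristic polynomial `φ'_B(λ) = - ∑_{j=0}^{N/2} b'_(j) λ^{N/2 - j}`. -/
def genCharPoly {p q : ℕ} (B : Cl p q) : Polynomial (Cl p q) :=
  -∑ j ∈ Finset.range (bigN p q / 2 + 1),
    Polynomial.monomial (bigN p q / 2 - j) (genCoeff B j)

/-- `D = - ∑_{j=0}^{N/2} A^{N/2 - j} b'_(j)`. -/
def elemD {p q : ℕ} (A B : Cl p q) : Cl p q :=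
  -∑ j ∈ Finset.range (bigN p q / 2 + 1), A ^ (bigN p q / 2 - j) * genCoeff B j

/-- `F = ∑_{j=1}^{N/2} A^{N/2 - j} C (B'_(j-1) - b'_(j-1))`. -/
def elemF {p q : ℕ} (A B C : Cl p q) : Cl p q :=
  ∑ j ∈ Finset.Icc 1 (bigN p q / 2),
    A ^ (bigN p q / 2 - j) * C * (genElt B (j - 1) - genCoeff B (j - 1))

end

end CliffordSylvester

open CliffordSylvester

/-! If `A * X - X * B = C`, centrality of the `b'_(j)` makes a telescoping sum collapse to `D * X =
F`, provided `B'_(N/2) = b'_(N/2)` (`elemD_mul_eq_elemF`). Likewise `D_(N) = d_(N)` says `D *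
(D_(N-1) - d_(N-1)) = d_(N)`, so `D` is invertible when `d_(N) ≠ 0`. This gives the formula and
uniqueness; existence follows because an injective endomorphism of a finite-dimensional space is
surjective.

Both terminal identities come from `faddeevLeVerrier`. Gamma matrices give a representation `ρ` on
complex matrices of size `N/2` sending the pseudoscalar to a scalar (`exists_rep`). Traces kill all
blades except grades `0` and `n`, so `ρ (cenProj U)` is the normalised trace of `ρ U`, and the
primed recursion maps to that of the matrix `ρ B`. Adding the twist of `ρ` by the grade involution
doubles the size to `N`, leaves only the scalar part in the trace, and makes the pair faithful
(`eq_of_rep_eq`). -/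

namespace CliffordSylvester

open Polynomial Matrix

/-! ### Adjugates and the Faddeev–LeVerrier recursion. -/

section FaddeevLeVerrier

variable {R ι : Type*} [CommRing R] [Fintype ι] [DecidableEq ι]

theorem derivative_det_eq_sum_updateCol (A : Matrix ι ι R[X]) :
    derivative A.det = ∑ i, (A.updateCol i fun j => derivative (A j i)).det := by
  simp only [det_apply, derivative_sum]
  rw [Finset.sum_comm]
  refine Finset.sum_congr rfl fun σ _ => ?_
  rw [← Finset.smul_sum, Units.smul_def, derivative_smul, derivative_prod_finset]
  congr 1
  refine Finset.sum_congr rfl fun i hi => ?_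
  rw [← Finset.mul_prod_erase _ _ hi, mul_comm]
  congr 1
  · simp
  · refine Finset.prod_congr rfl fun j hj => ?_
    rw [updateCol_ne (Finset.ne_of_mem_erase hj)]

/-- Jacobi's formula: the entrywise derivative of `X - M` is the identity, so each differentiated
column leaves a diagonal cofactor. -/
theorem derivative_charpoly_eq_trace_adjugate (M : Matrix ι ι R) :
    derivative M.charpoly = (charmatrix M).adjugate.trace := by
  rw [charpoly, derivative_det_eq_sum_updateCol, trace]
  refine Finset.sum_congr rfl fun i _ => ?_
  rw [diag_apply, ← transpose_apply (charmatrix M).adjugate, adjugate_transpose, adjugate_apply,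
    updateRow_transpose, det_transpose]
  congr 2
  funext j
  rcases eq_or_ne j i with rfl | h
  · simp
  · simp [h]

/-- The coefficients of the adjugate of the characteristic matrix. -/
noncomputable def adjugateCoeff (M : Matrix ι ι R) (k : ℕ) : Matrix ι ι R :=
  (matPolyEquiv (charmatrix M).adjugate).coeff k

theorem trace_adjugateCoeff (M : Matrix ι ι R) (k : ℕ) :
    (adjugateCoeff M k).trace = (k + 1) * M.charpoly.coeff (k + 1) := by
  have h := congrArg (fun f => f.coeff k) (derivative_charpoly_eq_trace_adjugate M)
  simp only [coeff_derivative, trace, finsetSum_coeff, diag_apply] at h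
  simp only [adjugateCoeff, trace, diag_apply, matPolyEquiv_coeff_apply]
  rw [← h, mul_comm]

theorem X_sub_C_mul_adjugate (M : Matrix ι ι R) :
    (X - C M) * matPolyEquiv (charmatrix M).adjugate
      = M.charpoly.map (algebraMap R (Matrix ι ι R)) := by
  rw [← matPolyEquiv_charmatrix, ← map_mul, mul_adjugate, ← charpoly, matPolyEquiv_smul_one]

theorem adjugateCoeff_sub_mul (M : Matrix ι ι R) (k : ℕ) :
    adjugateCoeff M k - M * adjugateCoeff M (k + 1)
      = algebraMap R (Matrix ι ι R) (M.charpoly.coeff (k + 1)) := by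
  have h := congrArg (fun f => f.coeff (k + 1)) (X_sub_C_mul_adjugate M)
  simpa [adjugateCoeff, sub_mul, coeff_X_mul, coeff_map] using h

theorem mul_adjugateCoeff_zero (M : Matrix ι ι R) :
    M * adjugateCoeff M 0 = -algebraMap R (Matrix ι ι R) (M.charpoly.coeff 0) := by
  have h := congrArg (fun f => f.coeff 0) (X_sub_C_mul_adjugate M)
  rw [eq_neg_iff_add_eq_zero, ← neg_eq_zero, neg_add, ← sub_eq_add_neg, sub_eq_zero]
  simpa [adjugateCoeff, sub_mul, coeff_map] using h

theorem adjugateCoeff_card [Nontrivial R] [Nonempty ι] (M : Matrix ι ι R) :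
    adjugateCoeff M (Fintype.card ι) = 0 := by
  refine coeff_eq_zero_of_natDegree_lt ?_
  have h := congrArg natDegree (X_sub_C_mul_adjugate M)
  rw [(M.charpoly_monic.natDegree_map _), charpoly_natDegree_eq_dim] at h
  by_cases h0 : matPolyEquiv (charmatrix M).adjugate = 0
  · rw [h0]; simpa using Fintype.card_pos
  · rw [(monic_X_sub_C M).natDegree_mul' h0, natDegree_X_sub_C] at h
    omega

/-- The **Faddeev–LeVerrier algorithm** ends with a scalar matrix. -/
theorem faddeevLeVerrier {K : Type*} [Field K] [CharZero K] [Nonempty ι]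
    (M : Matrix ι ι K) (S : ℕ → Matrix ι ι K) (h1 : S 1 = M)
    (hS : ∀ k, 1 ≤ k → S (k + 1) = M * (S k - algebraMap K _ ((S k).trace / k))) :
    S (Fintype.card ι) = algebraMap K _ ((S (Fintype.card ι)).trace / Fintype.card ι) := by
  -- The trace of `adjugateCoeff_sub_mul` turns `tr (S j)` into `k * c_k - (j + k) * c_k = -j *
  -- c_k`, where `c_k` is the coefficient of the characteristic polynomial.
  have key : ∀ j k, j + k = Fintype.card ι → 1 ≤ j → S j = M * adjugateCoeff M k →
      (S j).trace / j = -M.charpoly.coeff k := by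
    intro j k hjk hj h
    have hj' : (j : K) ≠ 0 := by exact_mod_cast (by omega : j ≠ 0)
    have hc : (Fintype.card ι : K) = j + k := by exact_mod_cast hjk.symm
    rw [div_eq_iff hj', h]
    cases k with
    | zero =>
      rw [mul_adjugateCoeff_zero, trace_neg, Algebra.algebraMap_eq_smul_one, trace_smul, trace_one, hc]
      simp
    | succ k =>
      have h2 := congrArg trace (adjugateCoeff_sub_mul M k)
      rw [trace_sub, trace_adjugateCoeff, Algebra.algebraMap_eq_smul_one, trace_smul, trace_one, hc,
        smul_eq_mul] at h2
      push_cast at h2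
      linear_combination -h2
  have main : ∀ j k, j + k = Fintype.card ι → 1 ≤ j → S j = M * adjugateCoeff M k := by
    intro j
    induction j with
    | zero => intro k _ h; omega
    | succ j ih =>
      intro k hjk _
      rcases Nat.eq_zero_or_pos j with rfl | hj
      -- Here `k` is the size minus one: the top adjugate coefficient is `1`, since the
      -- characteristic polynomial is monic.
      · have h2 := adjugateCoeff_sub_mul M k
        have hm : M.charpoly.coeff (k + 1) = 1 := by
          have := M.charpoly_monic.coeff_natDegree
          rwa [charpoly_natDegree_eq_dim, ← hjk, zero_add, add_comm] at this
        rw [show k + 1 = Fintype.card ι by omega, adjugateCoeff_card, mul_zero, sub_zero,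
          ← hjk, zero_add, add_comm, hm, map_one] at h2
        rw [zero_add, h1, h2, mul_one]
      · have h := ih (k + 1) (by omega) hj
        rw [hS j hj, key j (k + 1) (by omega) hj h, h, map_neg, sub_neg_eq_add,
          ← adjugateCoeff_sub_mul, add_sub_cancel]
  have hN := main _ 0 (add_zero _) Fintype.card_pos
  rw [key _ 0 (add_zero _) Fintype.card_pos hN, hN, mul_adjugateCoeff_zero, map_neg]

end FaddeevLeVerrier

/-! ### Gamma matrices in odd dimension. -/

section GammaMatrices

theorem prod_map_fromBlocks_antidiag {R ι : Type*} [CommRing R] [Fintype ι] [DecidableEq ι]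
    (l : List (Matrix ι ι R)) :
    (l.map fun E => fromBlocks 0 E E 0).prod =
      if Even l.length then fromBlocks l.prod 0 0 l.prod else fromBlocks 0 l.prod l.prod 0 := by
  induction l with
  | nil => simp
  | cons E l ih =>
    rw [List.map_cons, List.prod_cons, ih, List.length_cons, List.prod_cons]
    by_cases h : Even l.length <;> simp [h, Nat.even_add_one, fromBlocks_multiply]

/-- In odd dimension there are gamma matrices of size `2 ^ k` whose product is scalar. -/
theorem exists_gammaMatrices (k : ℕ) : ∀ (n : ℕ) (_ : n = 2 * k + 1) (s : Fin n → ℂ),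
    ∃ (ι : Type) (_ : Fintype ι) (_ : DecidableEq ι) (E : Fin n → Matrix ι ι ℂ) (c : ℂ),
      Fintype.card ι = 2 ^ k ∧
      (∀ a b, E a * E b + E b * E a = if a = b then (2 * s a ^ 2) • 1 else 0) ∧
      (List.ofFn E).prod = c • 1 := by
  induction k with
  | zero =>
    rintro n rfl s
    refine ⟨Unit, inferInstance, inferInstance, fun _ => s 0 • 1, s 0, by simp, ?_, by simp⟩
    intro a b
    obtain rfl : a = b := Subsingleton.elim (α := Fin 1) a b
    obtain rfl : a = 0 := Subsingleton.elim (α := Fin 1) a 0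
    simp only [smul_mul_smul_comm, ← add_smul, if_true, mul_one]
    congr 1; ring
  | succ k ih =>
    rintro n rfl s
    obtain ⟨ι, _, _, E, c, hc, hE, hp⟩ := ih (2 * k + 1) rfl fun a => s a.succ.succ
    -- Pauli doubling: `σ₂ ⊗ 1`, `σ₃ ⊗ 1` and `σ₁ ⊗ E a`. An odd number of factors `σ₁ ⊗ E a`
    -- multiplies to `σ₁ ⊗ c`, and `σ₂ σ₃ σ₁ = i`, so the full product stays scalar.
    set Y : Matrix (ι ⊕ ι) (ι ⊕ ι) ℂ := fromBlocks 0 (-Complex.I • 1) (Complex.I • 1) 0 with hY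
    set Z : Matrix (ι ⊕ ι) (ι ⊕ ι) ℂ := fromBlocks 1 0 0 (-1) with hZ
    have hYY : Y * Y = 1 := by simp [hY, fromBlocks_multiply, smul_smul]
    have hZZ : Z * Z = 1 := by simp [hZ, fromBlocks_multiply]
    have hYZ : Y * Z + Z * Y = 0 := by simp [hY, hZ, fromBlocks_multiply, fromBlocks_add]
    have hYE : ∀ M, Y * fromBlocks 0 M M 0 + fromBlocks 0 M M 0 * Y = 0 := fun M => by
      simp [hY, fromBlocks_multiply, fromBlocks_add]
    have hZE : ∀ M, Z * fromBlocks 0 M M 0 + fromBlocks 0 M M 0 * Z = 0 := fun M => by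
      simp [hZ, fromBlocks_multiply, fromBlocks_add]
    refine ⟨ι ⊕ ι, inferInstance, inferInstance,
      Fin.cons (s 0 • Y) (Fin.cons (s 1 • Z) fun a => fromBlocks 0 (E a) (E a) 0),
      s 0 * s 1 * Complex.I * c, ?_, ?_, ?_⟩
    · rw [Fintype.card_sum, hc]; ring
    · intro a b
      refine Fin.cases ?_ (fun a => Fin.cases ?_ (fun a => ?_) a) a <;>
        refine Fin.cases ?_ (fun b => Fin.cases ?_ (fun b => ?_) b) b
      · simp only [Fin.cons_zero, smul_mul_smul_comm, hYY, if_true, ← add_smul]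
        congr 1; ring
      · simp only [Fin.cons_zero, Fin.cons_succ, smul_mul_smul_comm, mul_comm (s 1), ← smul_add,
          hYZ, smul_zero, (Fin.succ_ne_zero _).symm, if_false]
      · simp only [Fin.cons_zero, Fin.cons_succ, smul_mul_assoc, mul_smul_comm, ← smul_add,
          hYE, smul_zero, (Fin.succ_ne_zero _).symm, if_false]
      · simp only [Fin.cons_zero, Fin.cons_succ, smul_mul_smul_comm, mul_comm (s 1), ← smul_add,
          add_comm (Z * Y), hYZ, smul_zero, Fin.succ_ne_zero, if_false]
      · simp only [Fin.cons_zero, Fin.cons_succ, smul_mul_smul_comm, hZZ, if_true, ← add_smul]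
        congr 1
        rw [← Fin.succ_zero_eq_one]
        change _ = 2 * s (Fin.succ 0) ^ 2
        ring
      · simp only [Fin.cons_zero, Fin.cons_succ, smul_mul_assoc, mul_smul_comm, ← smul_add,
          hZE, smul_zero, Fin.succ_inj, (Fin.succ_ne_zero _).symm, if_false]
      · simp only [Fin.cons_zero, Fin.cons_succ, smul_mul_assoc, mul_smul_comm, ← smul_add,
          add_comm _ (Y * _), hYE, smul_zero, Fin.succ_ne_zero, if_false]
      · simp only [Fin.cons_zero, Fin.cons_succ, smul_mul_assoc, mul_smul_comm, ← smul_add,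
          add_comm _ (Z * _), hZE, smul_zero, Fin.succ_inj, Fin.succ_ne_zero, if_false]
      · simp only [Fin.cons_succ, fromBlocks_multiply, fromBlocks_add, mul_zero, zero_mul, zero_add,
          add_zero, hE, Fin.succ_inj]
        split_ifs with h
        · rw [← fromBlocks_one, fromBlocks_smul, smul_zero]
        · exact fromBlocks_zero
    · rw [List.ofFn_succ, List.ofFn_succ, List.prod_cons, List.prod_cons]
      simp only [Fin.cons_zero, Fin.cons_succ]
      have h := prod_map_fromBlocks_antidiag (List.ofFn E)
      rw [List.map_ofFn, hp, List.length_ofFn, if_neg (by simp [parity_simps])] at h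
      have hYZI : Y * (Z * fromBlocks 0 (c • 1) (c • 1) 0) = (Complex.I * c) • 1 := by
        rw [← fromBlocks_one, fromBlocks_smul]
        simp [hY, hZ, fromBlocks_multiply, smul_smul, mul_comm c]
      rw [smul_mul_assoc, smul_mul_assoc, mul_smul_comm, smul_smul]
      erw [h]
      rw [hYZI, smul_smul, ← mul_assoc]

end GammaMatrices

/-! ### Signs of blades, the form `⟨U V⟩_0`, and tracial functionals. -/

section Blades

variable {p q : ℕ}

theorem gen_mul_self (a : Fin (p + q)) :
    gen p q a * gen p q a = algebraMap ℝ (Cl p q) (eta p q a) := by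
  have h := gen_mul_gen_add p q a a
  rw [if_pos rfl, ← two_mul, map_mul, map_ofNat] at h
  have h2 : (algebraMap ℝ (Cl p q) (1 / 2)) * 2 = 1 := by
    rw [← map_ofNat (algebraMap ℝ (Cl p q)), ← map_mul]; norm_num
  calc _ = (algebraMap ℝ (Cl p q) (1 / 2)) * 2 * (gen p q a * gen p q a) := by rw [h2, one_mul]
    _ = _ := by rw [mul_assoc, h, ← mul_assoc, h2, one_mul]

theorem eta_mul_self (a : Fin (p + q)) : eta p q a * eta p q a = 1 := by
  rw [eta]; split_ifs <;> norm_num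

theorem isUnit_gen (a : Fin (p + q)) : IsUnit (gen p q a) := by
  refine ⟨⟨gen p q a, eta p q a • gen p q a, ?_, ?_⟩, rfl⟩ <;>
  simp [gen_mul_self, Algebra.algebraMap_eq_smul_one, smul_smul, eta_mul_self]

theorem isUnit_blade (I : Finset (Fin (p + q))) : IsUnit (blade p q I) := by
  refine List.prod_isUnit fun x hx => ?_
  obtain ⟨a, -, rfl⟩ := List.mem_map.mp hx
  exact isUnit_gen a

/-- The linear map reversing the sign of the coordinate `a`. -/
noncomputable def signMap (a : Fin (p + q)) : (Fin (p + q) → ℝ) →ₗ[ℝ] (Fin (p + q) → ℝ) :=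
  LinearMap.pi fun b => (if b = a then -1 else 1 : ℝ) • LinearMap.proj b

theorem signMap_apply (a b : Fin (p + q)) (v : Fin (p + q) → ℝ) :
    signMap a v b = (if b = a then -1 else 1) * v b := rfl

/-- The automorphism reversing the sign of the generator `e_a`. -/
noncomputable def signAut (a : Fin (p + q)) : Cl p q →ₐ[ℝ] Cl p q :=
  CliffordAlgebra.lift (quadForm p q) ⟨(CliffordAlgebra.ι (quadForm p q)).comp (signMap a), by
    intro v
    rw [LinearMap.comp_apply, CliffordAlgebra.ι_sq_scalar]
    congr 1
    simp only [quadForm, QuadraticMap.weightedSumSquares_apply, signMap_apply]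
    refine Finset.sum_congr rfl fun b _ => ?_
    split_ifs <;> simp⟩

theorem signAut_gen (a b : Fin (p + q)) :
    signAut a (gen p q b) = (if b = a then -1 else 1 : ℝ) • gen p q b := by
  rw [signAut, gen, CliffordAlgebra.lift_ι_apply, LinearMap.comp_apply, ← map_smul]
  congr 1
  funext c
  rw [signMap_apply, Pi.smul_apply, smul_eq_mul]
  rcases eq_or_ne c b with rfl | h
  · rfl
  · rw [Pi.single_eq_of_ne h, mul_zero, mul_zero]

theorem signAut_list_prod (a : Fin (p + q)) (l : List (Fin (p + q))) (hl : l.Nodup) :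
    signAut a (l.map (gen p q)).prod = (if a ∈ l then -1 else 1 : ℝ) • (l.map (gen p q)).prod := by
  induction l with
  | nil => simp
  | cons b l ih =>
    obtain ⟨hb, hl⟩ := List.nodup_cons.mp hl
    rw [List.map_cons, List.prod_cons, map_mul, ih hl, signAut_gen, smul_mul_smul_comm]
    congr 1
    by_cases h : b = a
    · subst h; simp [hb]
    · simp [h, Ne.symm h]

theorem signAut_blade (a : Fin (p + q)) (I : Finset (Fin (p + q))) :
    signAut a (blade p q I) = (if a ∈ I then -1 else 1 : ℝ) • blade p q I := by
  rw [blade, signAut_list_prod a _ (I.sort_nodup _)]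
  simp

theorem scalarPart_eq_coord (U : Cl p q) : scalarPart U = (bladeBasis p q).coord ∅ U := rfl

theorem scalarPart_blade (I : Finset (Fin (p + q))) :
    scalarPart (blade p q I) = if I = ∅ then 1 else 0 := by
  rw [scalarPart, ← bladeBasis_apply, Module.Basis.repr_self, Finsupp.single_apply]

theorem blade_empty : blade p q ∅ = 1 := by simp [blade]

theorem scalarPart_signAut (a : Fin (p + q)) (U : Cl p q) : scalarPart (signAut a U) = scalarPart U := by
  have : (bladeBasis p q).coord ∅ ∘ₗ (signAut a).toLinearMap = (bladeBasis p q).coord ∅ := by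
    refine (bladeBasis p q).ext fun I => ?_
    rw [LinearMap.comp_apply, bladeBasis_apply, AlgHom.toLinearMap_apply, signAut_blade, map_smul,
      ← scalarPart_eq_coord, scalarPart_blade]
    by_cases h : I = ∅
    · subst h; simp
    · simp [h]
  exact LinearMap.congr_fun this U

/-- Some `e_a` occurs in exactly one of the two blades. Flipping its sign negates the product, as
`W` transforms like `blade p q I`, but preserves scalar parts. -/
theorem scalarPart_blade_mul_of_ne {I J : Finset (Fin (p + q))} (h : J ≠ I) {W : Cl p q}
    (hW : blade p q I * W = 1) : scalarPart (blade p q J * W) = 0 := by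
  obtain ⟨a, ha⟩ : ∃ a, ¬(a ∈ J ↔ a ∈ I) := by
    by_contra! h'
    exact h (Finset.ext h')
  have hf : signAut a W = (if a ∈ I then -1 else 1 : ℝ) • W := by
    refine (isUnit_blade I).mul_left_cancel ?_
    have h1 := congrArg (signAut a) hW
    rw [map_mul, signAut_blade, map_one, smul_mul_assoc] at h1
    rw [mul_smul_comm, hW, ← h1, smul_smul]
    split_ifs <;> simp
  have h2 := scalarPart_signAut a (blade p q J * W)
  rw [map_mul, signAut_blade, hf, smul_mul_smul_comm, scalarPart_eq_coord, map_smul,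
    ← scalarPart_eq_coord] at h2
  by_cases h3 : a ∈ J
  · have h4 : a ∉ I := by tauto
    simp [h3, h4] at h2; linarith
  · have h4 : a ∈ I := by tauto
    simp [h3, h4] at h2; linarith

/-- The bilinear form `(U, V) ↦ ⟨U V⟩_0` is nondegenerate. -/
theorem eq_zero_of_scalarPart_mul {U : Cl p q} (h : ∀ V, scalarPart (U * V) = 0) : U = 0 := by
  refine (bladeBasis p q).repr.map_eq_zero_iff.mp (Finsupp.ext fun I => ?_)
  obtain ⟨W, hW⟩ := (isUnit_blade I).exists_right_inv
  have hU := h W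
  rw [← (bladeBasis p q).sum_repr U, Finset.sum_mul, scalarPart_eq_coord, map_sum,
    Finset.sum_eq_single I] at hU
  · rw [smul_mul_assoc, map_smul, bladeBasis_apply, hW, ← scalarPart_eq_coord, ← blade_empty,
      scalarPart_blade, if_pos rfl] at hU
    simpa using hU
  · intro J _ hJ
    rw [smul_mul_assoc, map_smul, bladeBasis_apply, ← scalarPart_eq_coord,
      scalarPart_blade_mul_of_ne hJ hW, smul_zero]
  · simp

theorem gen_mul_gen_of_ne {a b : Fin (p + q)} (h : a ≠ b) :
    gen p q a * gen p q b = -(gen p q b * gen p q a) := by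
  have := gen_mul_gen_add p q a b
  rw [if_neg h, mul_zero, map_zero] at this
  exact eq_neg_of_add_eq_zero_left this

theorem gen_mul_list_prod (a : Fin (p + q)) (l : List (Fin (p + q))) :
    gen p q a * (l.map (gen p q)).prod
      = (-1 : ℝ) ^ (l.length + l.count a) • ((l.map (gen p q)).prod * gen p q a) := by
  induction l with
  | nil => simp
  | cons b l ih =>
    rw [List.map_cons, List.prod_cons, List.length_cons, List.count_cons]
    by_cases h : a = b
    · subst h
      rw [mul_assoc _ _ (gen p q a), ← mul_smul_comm, ih]
      have hp : (-1 : ℝ) ^ (l.length + 1 + (l.count a + 1)) = (-1) ^ (l.length + l.count a) := by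
        rw [show l.length + 1 + (l.count a + 1) = l.length + l.count a + 2 by ring, pow_add,
          neg_one_sq, mul_one]
      rw [beq_self_eq_true, if_pos rfl, hp]
    · rw [← mul_assoc, gen_mul_gen_of_ne h, neg_mul, mul_assoc, ih]
      have : (b == a) = false := by simpa using Ne.symm h
      rw [this, mul_smul_comm, ← mul_assoc, add_right_comm, pow_succ]
      simp

/-- Passing each factor costs a sign, except passing `e_a` itself; only the parity of the exponent
matters. -/
theorem gen_mul_blade (a : Fin (p + q)) (I : Finset (Fin (p + q))) :
    gen p q a * blade p q I
      = (-1 : ℝ) ^ (I.card + if a ∈ I then 1 else 0) • (blade p q I * gen p q a) := by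
  rw [blade, gen_mul_list_prod, Finset.length_sort]
  congr 3
  rw [List.Nodup.count (I.sort_nodup _)]
  simp

/-- A tracial functional sees only the blades of grades `0` and `n`. -/
theorem tracial_blade (τ : Cl p q →ₗ[ℝ] ℂ) (hτ : ∀ U W, τ (U * W) = τ (W * U))
    {I : Finset (Fin (p + q))} (h0 : I ≠ ∅) (h1 : I ≠ Finset.univ) : τ (blade p q I) = 0 := by
  -- An even blade anticommutes with any of its own generators, an odd one with any missing
  -- generator. Evaluating `τ` on `e_a e_I e_a` in two ways then gives opposite values.
  obtain ⟨a, ha⟩ : ∃ a, gen p q a * blade p q I = -(blade p q I * gen p q a) := by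
    rcases Nat.even_or_odd I.card with he | ho
    · obtain ⟨a, ha⟩ := Finset.nonempty_iff_ne_empty.mpr h0
      refine ⟨a, ?_⟩
      rw [gen_mul_blade, if_pos ha, he.add_one.neg_one_pow, neg_one_smul]
    · obtain ⟨a, ha⟩ : ∃ a, a ∉ I := by
        by_contra! h
        exact h1 (Finset.eq_univ_iff_forall.mpr h)
      refine ⟨a, ?_⟩
      rw [gen_mul_blade, if_neg ha, add_zero, ho.neg_one_pow, neg_one_smul]
  have h2 : τ (gen p q a * (blade p q I * gen p q a)) = eta p q a • τ (blade p q I) := by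
    rw [hτ, mul_assoc, gen_mul_self, ← Algebra.commutes, ← Algebra.smul_def, map_smul]
  have h3 : τ (gen p q a * (blade p q I * gen p q a)) = -(eta p q a • τ (blade p q I)) := by
    rw [← mul_assoc, ha, neg_mul, mul_assoc, gen_mul_self, ← Algebra.commutes, ← Algebra.smul_def,
      map_neg, map_smul]
  have h4 : eta p q a • τ (blade p q I) = 0 := by
    rw [h2] at h3
    exact self_eq_neg.mp h3
  rw [← one_smul ℝ (τ _), ← eta_mul_self a, ← smul_smul, h4, smul_zero]

end Blades

/-! ### The matrix representation and its twist by the grade involution. -/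

section Representation

variable {p q : ℕ}

theorem blade_univ : blade p q Finset.univ = (List.ofFn (gen p q)).prod := by
  rw [blade, Fin.sort_univ, List.ofFn_eq_map]

theorem exists_rep (hn : Odd (p + q)) :
    ∃ (ι : Type) (_ : Fintype ι) (_ : DecidableEq ι) (ρ : Cl p q →ₐ[ℝ] Matrix ι ι ℂ) (c : ℂ),
      2 * Fintype.card ι = bigN p q ∧ ρ (blade p q Finset.univ) = c • 1 := by
  obtain ⟨k, hk⟩ := hn
  -- Square roots of the `η_a`, available over `ℂ`.
  let s : Fin (p + q) → ℂ := fun a => if (a : ℕ) < p then 1 else Complex.I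
  have hs : ∀ a, s a ^ 2 = (eta p q a : ℂ) := fun a => by
    simp only [s, eta]; split_ifs <;> simp
  obtain ⟨ι, _, _, E, c, hc, hE, hp⟩ := exists_gammaMatrices k (p + q) hk s
  have hsq : ∀ v, Fintype.linearCombination ℝ E v * Fintype.linearCombination ℝ E v
      = algebraMap ℝ (Matrix ι ι ℂ) (quadForm p q v) := by
    intro v
    -- Doubling allows symmetrising the double sum, so that only anticommutators remain.
    have h2 : (2 : ℝ) • (Fintype.linearCombination ℝ E v * Fintype.linearCombination ℝ E v)
        = (2 : ℝ) • algebraMap ℝ (Matrix ι ι ℂ) (quadForm p q v) := by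
      simp only [two_smul, Fintype.linearCombination_apply, Finset.sum_mul_sum, smul_mul_smul_comm]
      conv_lhs => arg 2; rw [Finset.sum_comm]
      rw [← Finset.sum_add_distrib, ← map_add, quadForm, QuadraticMap.weightedSumSquares_apply,
        ← Finset.sum_add_distrib, map_sum]
      refine Finset.sum_congr rfl fun a _ => ?_
      rw [← Finset.sum_add_distrib, Finset.sum_eq_single a]
      · rw [← smul_add, hE, if_pos rfl, hs,
          IsScalarTower.algebraMap_apply ℝ ℂ (Matrix ι ι ℂ), Algebra.algebraMap_eq_smul_one,
          ← smul_assoc]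
        congr 1
        simp only [Complex.real_smul, smul_eq_mul, Complex.coe_algebraMap]
        push_cast
        ring
      · intro b _ hb
        rw [mul_comm (v b), ← smul_add, hE, if_neg hb.symm, smul_zero]
      · simp
    exact smul_right_injective _ (two_ne_zero' ℝ) h2
  refine ⟨ι, inferInstance, inferInstance, CliffordAlgebra.lift (quadForm p q)
    ⟨Fintype.linearCombination ℝ E, hsq⟩, c, ?_, ?_⟩
  · rw [hc, bigN, hk, show (2 * k + 1 + 1) / 2 = k + 1 by omega, pow_succ']
  · rw [blade_univ, map_list_prod, List.map_ofFn, ← hp]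
    congr 2
    funext a
    simp [gen, Fintype.linearCombination_apply_single]

theorem gradeProj_top (U : Cl p q) : gradeProj (p + q) U
    = (bladeBasis p q).repr U Finset.univ • blade p q Finset.univ := by
  have : (Finset.univ.filter fun I : Finset (Fin (p + q)) => I.card = p + q) = {Finset.univ} := by
    ext I
    simpa using (Finset.card_eq_iff_eq_univ I).trans Iff.rfl
  rw [gradeProj, this, Finset.sum_singleton]

variable {ι : Type} [Fintype ι] [DecidableEq ι]

/-- The trace of a representation, as a real linear functional. -/
noncomputable def repTrace (ρ : Cl p q →ₐ[ℝ] Matrix ι ι ℂ) : Cl p q →ₗ[ℝ] ℂ :=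
  Matrix.traceLinearMap ι ℝ ℂ ∘ₗ ρ.toLinearMap

theorem repTrace_apply (ρ : Cl p q →ₐ[ℝ] Matrix ι ι ℂ) (U : Cl p q) :
    repTrace ρ U = (ρ U).trace := rfl

theorem repTrace_mul_comm (ρ : Cl p q →ₐ[ℝ] Matrix ι ι ℂ) (U V : Cl p q) :
    repTrace ρ (U * V) = repTrace ρ (V * U) := by
  rw [repTrace_apply, repTrace_apply, map_mul, map_mul, trace_mul_comm]

theorem repTrace_eq (hn : Odd (p + q)) (ρ : Cl p q →ₐ[ℝ] Matrix ι ι ℂ) (U : Cl p q) :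
    repTrace ρ U = scalarPart U * Fintype.card ι
      + (bladeBasis p q).repr U Finset.univ * repTrace ρ (blade p q Finset.univ) := by
  have hne : (∅ : Finset (Fin (p + q))) ≠ Finset.univ := by
    intro h
    have := congrArg Finset.card h
    rw [Finset.card_empty, Finset.card_univ, Fintype.card_fin] at this
    rw [← this] at hn
    simp at hn
  conv_lhs => rw [← (bladeBasis p q).sum_repr U, map_sum]
  rw [← Finset.sum_subset (Finset.subset_univ {∅, Finset.univ}), Finset.sum_pair hne]
  · simp only [map_smul, bladeBasis_apply, blade_empty, Complex.real_smul]
    rw [repTrace_apply ρ 1, map_one, trace_one, scalarPart]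
  · intro I _ hI
    rw [Finset.mem_insert, Finset.mem_singleton, not_or] at hI
    rw [map_smul, bladeBasis_apply, tracial_blade _ (repTrace_mul_comm ρ) hI.1 hI.2, smul_zero]

theorem rep_cenProj [Nonempty ι] (hn : Odd (p + q)) (ρ : Cl p q →ₐ[ℝ] Matrix ι ι ℂ) {c : ℂ}
    (hc : ρ (blade p q Finset.univ) = c • 1) (U : Cl p q) :
    ρ (cenProj U) = algebraMap ℂ _ ((ρ U).trace / Fintype.card ι) := by
  have h0 : (Fintype.card ι : ℂ) ≠ 0 := by exact_mod_cast Fintype.card_ne_zero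
  have h : (ρ U).trace / Fintype.card ι
      = (scalarPart U : ℂ) + (bladeBasis p q).repr U Finset.univ * c := by
    rw [← repTrace_apply, repTrace_eq hn, repTrace_apply, hc, trace_smul, trace_one, smul_eq_mul]
    field_simp
  rw [h, cenProj, ← algebraMap_scalarPart, gradeProj_top, map_add, map_smul, hc, AlgHom.commutes,
    map_add, IsScalarTower.algebraMap_apply ℝ ℂ (Matrix ι ι ℂ), ← smul_assoc,
    Algebra.algebraMap_eq_smul_one (_ * _), Complex.real_smul]
  rfl

theorem involute_blade_univ (hn : Odd (p + q)) :
    CliffordAlgebra.involute (blade p q Finset.univ) = -blade p q Finset.univ := by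
  have h := CliffordAlgebra.involute_prod_map_ι (Q := quadForm p q)
    ((Finset.univ.sort (· ≤ ·)).map fun a : Fin (p + q) => Pi.single a (1 : ℝ))
  rw [List.map_map, List.length_map, Finset.length_sort, Finset.card_univ, Fintype.card_fin,
    hn.neg_one_pow, neg_one_smul] at h
  exact h

/-- For odd `n` the involution negates the pseudoscalar, so its contributions cancel. -/
theorem trace_add_trace_involute (hn : Odd (p + q)) (ρ : Cl p q →ₐ[ℝ] Matrix ι ι ℂ) (U : Cl p q) :
    (ρ U).trace + (ρ (CliffordAlgebra.involute U)).trace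
      = 2 * Fintype.card ι * scalarPart U := by
  have h1 := repTrace_eq hn ρ U
  have h2 := repTrace_eq hn (ρ.comp CliffordAlgebra.involute) U
  have h3 : repTrace (ρ.comp CliffordAlgebra.involute) (blade p q Finset.univ)
      = -repTrace ρ (blade p q Finset.univ) := by
    rw [repTrace_apply, AlgHom.comp_apply, involute_blade_univ hn, map_neg, trace_neg,
      repTrace_apply]
  rw [h3] at h2
  simp only [repTrace_apply, AlgHom.comp_apply] at h1 h2
  linear_combination h1 + h2

/-- The two traces recover `⟨(U - V) W⟩_0`, and that form is nondegenerate. One `ρ` need not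
suffice: when the pseudoscalar squares to `1`, it differs from a real scalar that has the same
image. -/
theorem eq_of_rep_eq [Nonempty ι] (hn : Odd (p + q)) (ρ : Cl p q →ₐ[ℝ] Matrix ι ι ℂ) {U V : Cl p q}
    (h1 : ρ U = ρ V)
    (h2 : ρ (CliffordAlgebra.involute U) = ρ (CliffordAlgebra.involute V)) : U = V := by
  refine sub_eq_zero.mp (eq_zero_of_scalarPart_mul fun W => ?_)
  have h := trace_add_trace_involute hn ρ ((U - V) * W)
  rw [map_mul, map_mul, map_mul, map_sub, map_sub, map_sub, h1, h2, sub_self, sub_self, zero_mul,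
    zero_mul, trace_zero, add_zero] at h
  have h0 : (Fintype.card ι : ℂ) ≠ 0 := by exact_mod_cast Fintype.card_ne_zero
  simpa [h0] using h.symm

end Representation

/-! ### Termination of the recursions and the Sylvester equation. -/

section Sequences

variable {p q : ℕ}

/-- The conventions `B'_(0) = 0` and `b'_(0) = -1` make the recursion valid from `k = 0`. -/
theorem genElt_succ {B : Cl p q} {k : ℕ} :
    genElt B (k + 1) = B * (genElt B k - genCoeff B k) := by
  cases k with
  | zero => simp [genElt, genCoeff, genCoeffOf]
  | succ k => rfl

theorem charElt_succ {U : Cl p q} {k : ℕ} :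
    charElt U (k + 1) = U * (charElt U k - algebraMap ℝ (Cl p q) (charCoeff U k)) := by
  cases k with
  | zero => simp [charElt, charCoeff, coeffOf]
  | succ k => rfl

theorem bigN_pos : 0 < bigN p q := Nat.two_pow_pos _

section Rep

variable {ι : Type} [Fintype ι] [DecidableEq ι] [Nonempty ι]

theorem rep_genCoeff (hn : Odd (p + q)) (ρ : Cl p q →ₐ[ℝ] Matrix ι ι ℂ) {c : ℂ}
    (hc : ρ (blade p q Finset.univ) = c • 1) (hcard : 2 * Fintype.card ι = bigN p q)
    (B : Cl p q) {k : ℕ} (hk : k ≠ 0) :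
    ρ (genCoeff B k) = algebraMap ℂ _ ((ρ (genElt B k)).trace / k) := by
  have h0 : (Fintype.card ι : ℂ) ≠ 0 := by exact_mod_cast Fintype.card_ne_zero
  rw [genCoeff, genCoeffOf, if_neg hk, map_smul, rep_cenProj hn ρ hc, ← hcard,
    Algebra.algebraMap_eq_smul_one, Algebra.algebraMap_eq_smul_one, ← smul_assoc,
    Complex.real_smul]
  congr 1
  push_cast
  field_simp

theorem rep_genElt (hn : Odd (p + q)) (ρ : Cl p q →ₐ[ℝ] Matrix ι ι ℂ) {c : ℂ}
    (hc : ρ (blade p q Finset.univ) = c • 1) (hcard : 2 * Fintype.card ι = bigN p q) (B : Cl p q) :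
    ρ (genElt B (Fintype.card ι)) = ρ (genCoeff B (Fintype.card ι)) := by
  rw [rep_genCoeff hn ρ hc hcard B Fintype.card_ne_zero]
  refine faddeevLeVerrier (ρ B) (fun k => ρ (genElt B k)) rfl fun k hk => ?_
  simp only [genElt_succ, map_mul, map_sub]
  rw [rep_genCoeff hn ρ hc hcard B (by omega)]

theorem charElt_bigN_of_rep (hn : Odd (p + q)) (ρ : Cl p q →ₐ[ℝ] Matrix ι ι ℂ)
    (hcard : 2 * Fintype.card ι = bigN p q) (U : Cl p q) :
    charElt U (bigN p q) = algebraMap ℝ (Cl p q) (charCoeff U (bigN p q)) := by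
  -- The block sum has size `N` and trace `N * scalarPart V`, matching the normalisation in
  -- `coeffOf`.
  let σ : Cl p q → Matrix (ι ⊕ ι) (ι ⊕ ι) ℂ := fun V =>
    fromBlocks (ρ V) 0 0 (ρ (CliffordAlgebra.involute V))
  have hσ : ∀ k ≠ 0, algebraMap ℂ (Matrix (ι ⊕ ι) (ι ⊕ ι) ℂ) ((σ (charElt U k)).trace / k)
      = σ (algebraMap ℝ (Cl p q) (charCoeff U k)) := by
    intro k hk
    simp only [σ]
    have ht : ∀ P Q : Matrix ι ι ℂ, (fromBlocks P 0 0 Q).trace = P.trace + Q.trace := fun P Q => by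
      simp [trace, Fintype.sum_sum_type]
    rw [ht, trace_add_trace_involute hn, charCoeff, coeffOf, if_neg hk, ← hcard]
    simp only [AlgHom.commutes]
    rw [IsScalarTower.algebraMap_apply ℝ ℂ (Matrix ι ι ℂ), Algebra.algebraMap_eq_smul_one,
      Algebra.algebraMap_eq_smul_one, ← fromBlocks_one, fromBlocks_smul, smul_zero]
    have hz : (2 * Fintype.card ι * scalarPart (charElt U k) / k : ℂ)
        = algebraMap ℝ ℂ ((2 * Fintype.card ι : ℕ) / k * scalarPart (charElt U k)) := by
      rw [Complex.coe_algebraMap]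
      push_cast
      ring
    rw [hz]
  have hmul : ∀ V W, σ (V * W) = σ V * σ W := fun V W => by simp [σ, fromBlocks_multiply]
  have hsub : ∀ V W, σ (V - W) = σ V - σ W := fun V W => by
    rw [eq_sub_iff_add_eq]; simp [σ, fromBlocks_add]
  have h := faddeevLeVerrier (σ U) (fun k => σ (charElt U k)) rfl fun k hk => by
    rw [hσ k (by omega), charElt_succ, hmul, hsub]
  rw [hσ _ Fintype.card_ne_zero, Fintype.card_sum, ← two_mul, hcard] at h
  obtain ⟨h1, -, -, h2⟩ := fromBlocks_inj.mp h
  exact eq_of_rep_eq hn ρ h1 h2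

end Rep

theorem charElt_bigN (hn : Odd (p + q)) (U : Cl p q) :
    charElt U (bigN p q) = algebraMap ℝ (Cl p q) (charCoeff U (bigN p q)) := by
  obtain ⟨ι, _, _, ρ, c, hcard, -⟩ := exists_rep hn
  have hpos := bigN_pos (p := p) (q := q)
  have : Nonempty ι := Fintype.card_pos_iff.mp (by omega)
  exact charElt_bigN_of_rep hn ρ hcard U

theorem genElt_bigN_div_two (hn : Odd (p + q)) (B : Cl p q) :
    genElt B (bigN p q / 2) = genCoeff B (bigN p q / 2) := by
  obtain ⟨ι, _, _, ρ, c, hcard, hc⟩ := exists_rep hn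
  have hpos := bigN_pos (p := p) (q := q)
  have : Nonempty ι := Fintype.card_pos_iff.mp (by omega)
  have hm : bigN p q / 2 = Fintype.card ι := by omega
  rw [hm]
  refine eq_of_rep_eq hn ρ (rep_genElt hn ρ hc hcard B)
    (rep_genElt hn (ρ.comp CliffordAlgebra.involute) (c := -c) ?_ hcard B)
  rw [AlgHom.comp_apply, involute_blade_univ hn, map_neg, hc, neg_smul]

theorem gen_commute_blade_univ (hn : Odd (p + q)) (a : Fin (p + q)) :
    Commute (gen p q a) (blade p q Finset.univ) := by
  rw [Commute, SemiconjBy, gen_mul_blade, if_pos (Finset.mem_univ a), Finset.card_univ,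
    Fintype.card_fin, hn.add_one.neg_one_pow, one_smul]

theorem mem_center_of_commute_gen {U : Cl p q} (h : ∀ a, Commute (gen p q a) U) :
    U ∈ Subalgebra.center ℝ (Cl p q) := by
  refine Subalgebra.mem_center_iff.mpr fun V => ?_
  rw [← (bladeBasis p q).sum_repr V]
  refine Commute.sum_left _ _ _ fun I _ => Commute.smul_left ?_ _
  rw [bladeBasis_apply]
  refine Commute.list_prod_left _ _ fun x hx => ?_
  obtain ⟨a, -, rfl⟩ := List.mem_map.mp hx
  exact h a

theorem cenProj_mem_center (hn : Odd (p + q)) (U : Cl p q) :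
    cenProj U ∈ Subalgebra.center ℝ (Cl p q) := by
  rw [cenProj, ← algebraMap_scalarPart, gradeProj_top]
  exact add_mem (Subalgebra.algebraMap_mem _ _)
    (Subalgebra.smul_mem _ (mem_center_of_commute_gen (gen_commute_blade_univ hn)) _)

theorem genCoeff_mem_center (hn : Odd (p + q)) (B : Cl p q) (k : ℕ) :
    genCoeff B k ∈ Subalgebra.center ℝ (Cl p q) := by
  rw [genCoeff, genCoeffOf]
  split_ifs
  · exact neg_mem (one_mem _)
  · exact Subalgebra.smul_mem _ (cenProj_mem_center hn _) _

theorem coeff_genCharPoly (B : Cl p q) : (genCharPoly B).coeff (bigN p q / 2) = 1 := by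
  rw [genCharPoly, Polynomial.coeff_neg, Polynomial.finsetSum_coeff, Finset.sum_eq_single 0]
  · simp [genCoeff, genCoeffOf]
  · intro j hj hj0
    rw [Finset.mem_range] at hj
    exact Polynomial.coeff_monomial_of_ne _ (by omega)
  · simp

theorem natDegree_genCharPoly_le (B : Cl p q) :
    (genCharPoly B).natDegree ≤ bigN p q / 2 := by
  rw [genCharPoly, Polynomial.natDegree_neg]
  refine Polynomial.natDegree_sum_le_of_forall_le _ _ fun j _ => ?_
  exact (Polynomial.natDegree_monomial_le _).trans (Nat.sub_le _ _)

/-- Evaluation puts coefficients on the left, `elemD` on the right; centrality reconciles them. -/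
theorem elemD_eq_eval (hn : Odd (p + q)) (A B : Cl p q) :
    elemD A B = (genCharPoly B).eval A := by
  rw [elemD, genCharPoly, Polynomial.eval_neg, Polynomial.eval_finsetSum]
  congr 1
  refine Finset.sum_congr rfl fun j _ => ?_
  rw [Polynomial.eval_monomial]
  exact Subalgebra.mem_center_iff.mp (genCoeff_mem_center hn B j) _

/-- Eliminating `C` from the Sylvester equation. -/
theorem elemD_mul_eq_elemF (hn : Odd (p + q)) {A B C X : Cl p q} (h : A * X - X * B = C) :
    elemD A B * X = elemF A B C := by
  -- Substituting `C = A * X - X * B` telescopes; the last term is the remainder, which vanishes at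
  -- `m = N/2`.
  have key : ∀ m ≤ bigN p q / 2,
      ∑ j ∈ Finset.range m,
        A ^ (bigN p q / 2 - (j + 1)) * C * (genElt B j - genCoeff B j)
      = -∑ j ∈ Finset.range (m + 1), A ^ (bigN p q / 2 - j) * genCoeff B j * X
        - A ^ (bigN p q / 2 - m) * X * (genElt B m - genCoeff B m) := by
    intro m
    induction m with
    | zero =>
      intro _
      simp [genCoeff, genCoeffOf, genElt]
    | succ m ih =>
      intro hm
      rw [Finset.sum_range_succ, ih (by omega), Finset.sum_range_succ _ (m + 1)]
      have hA : A ^ (bigN p q / 2 - m) = A ^ (bigN p q / 2 - (m + 1)) * A := by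
        rw [← pow_succ]; congr 1; omega
      have hb := Subalgebra.mem_center_iff.mp (genCoeff_mem_center hn B (m + 1)) X
      rw [hA, ← h, genElt_succ, mul_assoc _ (genCoeff B (m + 1)), ← hb]
      noncomm_ring
  have hF := key _ le_rfl
  rw [genElt_bigN_div_two hn, sub_self, mul_zero, sub_zero] at hF
  rw [elemD, elemF, neg_mul, Finset.sum_mul, ← hF, ← Finset.Ico_add_one_right_eq_Icc,
    Finset.sum_Ico_eq_sum_range]
  refine Finset.sum_congr (by simp) fun j _ => ?_
  rw [add_comm 1 j, Nat.add_sub_cancel]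

/-- The linear map `X ↦ A X - X B` of the Sylvester equation. -/
noncomputable def sylvester (A B : Cl p q) : Cl p q →ₗ[ℝ] Cl p q :=
  LinearMap.mulLeft ℝ A - LinearMap.mulRight ℝ B

theorem sylvester_iff (hn : Odd (p + q)) (A B C X : Cl p q)
    (hd : charCoeff (elemD A B) (bigN p q) ≠ 0) :
    A * X - X * B = C ↔
      X = (charCoeff (elemD A B) (bigN p q))⁻¹ •
        ((charElt (elemD A B) (bigN p q - 1)
          - algebraMap ℝ (Cl p q) (charCoeff (elemD A B) (bigN p q - 1))) * elemF A B C) := by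
  set D := elemD A B with hD
  set d := charCoeff D (bigN p q) with hd'
  set G := charElt D (bigN p q - 1) - algebraMap ℝ (Cl p q) (charCoeff D (bigN p q - 1))
  have hfin : FiniteDimensional ℝ (Cl p q) := (bladeBasis p q).finiteDimensional_of_finite
  -- Makes the right inverse of `D` two-sided.
  have : IsNoetherianRing (Cl p q) := isNoetherian_of_tower ℝ inferInstance
  have hDG : D * (d⁻¹ • G) = 1 := by
    have h := charElt_succ (U := D) (k := bigN p q - 1)
    rw [Nat.sub_add_cancel bigN_pos, charElt_bigN hn] at h
    rw [mul_smul_comm, ← h, ← hd', Algebra.algebraMap_eq_smul_one, smul_smul,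
      inv_mul_cancel₀ hd, one_smul]
  have hGD : d⁻¹ • G * D = 1 := mul_eq_one_comm.mp hDG
  have hsol : ∀ {C Y}, A * Y - Y * B = C → Y = d⁻¹ • (G * elemF A B C) := fun {C Y} hY => by
    rw [← elemD_mul_eq_elemF hn hY, ← smul_mul_assoc, ← mul_assoc, hGD, one_mul]
  refine ⟨hsol, fun hX => ?_⟩
  -- `hsol` holds for every right-hand side, so two elements with the same image are given by the
  -- same formula.
  have hinj : Function.Injective (sylvester A B) := fun Y Z hYZ =>
    (hsol hYZ).trans (hsol rfl).symm
  obtain ⟨Y, hY⟩ := LinearMap.injective_iff_surjective.mp hinj C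
  rw [hX, ← hsol hY]
  exact hY

end Sequences

end CliffordSylvester

theorem mainTheorem5 (p q : ℕ) (hn : Odd (p + q)) (A B C : Cl p q) :
    (∀ k ≤ bigN p q / 2, genCoeff B k ∈ Subalgebra.center ℝ (Cl p q)) ∧
    ((genCharPoly B).Monic ∧ (genCharPoly B).natDegree = bigN p q / 2 ∧
      elemD A B = (genCharPoly B).eval A) ∧
    (charCoeff (elemD A B) (bigN p q) ≠ 0 →
      ∀ X : Cl p q, A * X - X * B = C ↔
        X = (charCoeff (elemD A B) (bigN p q))⁻¹ •
          ((charElt (elemD A B) (bigN p q - 1)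
            - algebraMap ℝ (Cl p q) (charCoeff (elemD A B) (bigN p q - 1)))
            * elemF A B C)) := by
  refine ⟨fun k _ => genCoeff_mem_center hn B k, ⟨?_, ?_, elemD_eq_eval hn A B⟩,
    fun hd X => sylvester_iff hn A B C X hd⟩
  · exact Polynomial.monic_of_natDegree_le_of_coeff_eq_one _ (natDegree_genCharPoly_le B)
      (coeff_genCharPoly B)
  · exact Polynomial.natDegree_eq_of_le_of_coeff_ne_zero (natDegree_genCharPoly_le B)
      (by rw [coeff_genCharPoly]; exact one_ne_zero)
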